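/- Let $x<L$, let $b\in\mathcal C^1(]-\infty,L])$ and put $\gamma=\frac{b^2+b'}{2}$ on $]-\infty,L]$. Assume that there are constants $\kappa>\gamma_0>0$ with $\gamma_0\le\gamma(y)\le\kappa$ for all $y\le L$. Let $K$ be any dominating constant with $\kappa-\gamma_0\le K\le\kappa$ (in particular $K=\kappa$ or $K=\kappa-\gamma_0$). One iteration of Algorithm $(A1)_{\rm shift}$, for the simulation of the first-passage time through $L$ of the diffusion $dX_t=b(X_t)\,dt+dB_t$, $X_0=x$, uses mutually independent random variables: a proposal $T$; exponential variables $e_1,e_2,\dots$ with mean $1/K$; uniform variables $V_1,V_2,\dots$ on $[0,1]$; standard Gaussian vectors $G_1,G_2,\dots$ in $\mathbb R^3$. Put $\mathcal E_0=0$, $\mathcal E_k=e_1+\dots+e_k$, $\beta_0=0\in\mathbb R^3$. As long as $\mathcal E_k\le T$ and no earlier point has been rejected, compute $$\beta_k=\frac{T-\mathcal E_k}{T-\mathcal E_{k-1}}\,\beta_{k-1}+\sqrt{\frac{(T-\mathcal E_k)(\mathcal E_k-\mathcal E_{k-1})}{T-\mathcal E_{k-1}}}\;G_k ,$$ and reject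 at the $k$-th point if $$K V_k\le \gamma\Big(L-\Big\|\tfrac{\mathcal E_k (L-x)}{T}(1,0,0)+\beta_k\Big\|\Big)-\gamma_0 .$$ The number $\mathcal N_1$ of random points used in the (first) iteration is the smallest $k\ge1$ such that $\mathcal E_k>T$ or the rejection occurs at the $k$-th point ($\mathcal N_1=\infty$ if there is no such $k$). Suppose that $T$ has the inverse Gaussian law ${\rm IG}(m,\lambda)$ with $m=\frac{L-x}{\sqrt{2\gamma_0}}$ and $\lambda=(L-x)^2$, i.e. the density $t\mapsto\sqrt{\frac{\lambda}{2\pi t^3}}\exp\Big(-\frac{\lambda(t-m)^2}{2m^2t}\Big)$ on $]0,\infty[$. Then $\mathcal N_1$ is an (almost everywhere measurable) random variable and $$\mathbb E[\mathcal N_1]\le 1+\kappa\,\frac{L-x}{\sqrt{2\gamma_0}} .$$ -/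

import Mathlib

open MeasureTheory ProbabilityTheory
open scoped ENNReal

noncomputable section

/-- The function `(b² + b') / 2` attached to a drift `b` on `]-∞, L]`; at the endpoint `L` the
derivative is the left derivative. -/
def driftGamma (b : ℝ → ℝ) (L y : ℝ) : ℝ :=
  ((b y) ^ 2 + derivWithin b (Set.Iic L) y) / 2

/-- The inverse Gaussian law `IG(m, l)` (mean parameter `m`, shape parameter `l`), given by its
density `√(l / (2 π t³)) exp (- l (t - m)² / (2 m² t))` on `]0, ∞[`. -/
def invGaussianMeasure (m l : ℝ) : Measure ℝ :=
  (volume.restrict (Set.Ioi (0 : ℝ))).withDensity fun t =>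
    ENNReal.ofReal (Real.sqrt (l / (2 * Real.pi * t ^ 3)) *
      Real.exp (-(l * (t - m) ^ 2) / (2 * m ^ 2 * t)))

/-- Names of the real random variables drawn during one iteration of the algorithm: the proposal
`T`, the exponential gaps, the uniform variables, and the coordinates of the 3-dimensional
Gaussian variables. -/
inductive Draw where
  | proposal : Draw
  | gap : ℕ → Draw
  | unif : ℕ → Draw
  | gauss : ℕ → Fin 3 → Draw

/-- The laws of the draws: `lawT` for the proposal, exponential with mean `1 / K` for the gaps,
uniform on `[0, 1]`, standard Gaussian for every coordinate of a Gaussian vector. -/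
def drawLaw (lawT : Measure ℝ) (K : ℝ) : Draw → Measure ℝ
  | .proposal => lawT
  | .gap _ => expMeasure K
  | .unif _ => volume.restrict (Set.Icc (0 : ℝ) 1)
  | .gauss _ _ => gaussianReal 0 1

/-- The variables of the algorithm: the position `β` of the Brownian bridge, the rejection flag
`W` (true when `𝒲 = 1`), the previous point `E0` and the current point `E1`. -/
structure LoopState where
  β : EuclideanSpace ℝ (Fin 3)
  W : Prop
  E0 : ℝ
  E1 : ℝ

/-- One execution of the body of the loop (Steps 2.1 and 2.2) for the rejection function `g`, the
dominating constant `K`, level `L` and starting point `x`, with proposal `T`, fresh Gaussian vector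
`G`, fresh exponential variable `e` and fresh uniform variable `V`. -/
def loopStep (g : ℝ → ℝ) (K L x T : ℝ) (G : EuclideanSpace ℝ (Fin 3)) (e V : ℝ)
    (s : LoopState) : LoopState :=
  let β' : EuclideanSpace ℝ (Fin 3) :=
    ((T - s.E1) / (T - s.E0)) • s.β +
      Real.sqrt ((T - s.E1) * (s.E1 - s.E0) / (T - s.E0)) • G
  { β := β'
    W := K * V ≤ g (L - ‖(s.E1 * (L - x) / T) • EuclideanSpace.single (0 : Fin 3) (1 : ℝ) + β'‖)
    E0 := s.E1
    E1 := s.E1 + e }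

/-- The variables of the algorithm after `n` executions of the body of the loop, as a function of
the draws `u`. The values are meaningful up to the first time the loop stops. -/
def loopState (g : ℝ → ℝ) (K L x : ℝ) (u : Draw → ℝ) : ℕ → LoopState
  | 0 => { β := 0, W := False, E0 := 0, E1 := u (.gap 0) }
  | n + 1 => loopStep g K L x (u .proposal) (WithLp.toLp 2 fun j => u (.gauss n j))
      (u (.gap (n + 1))) (u (.unif n)) (loopState g K L x u n)

/-- The number of random points used in one iteration. The `k`-th point (`k ≥ 1`) is the value of
`E1` after `k - 1` executions of the body of the loop; the iteration ends at the first point that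
is larger than `T` or that is at most `T` and sets the rejection flag `W`, and this last point is
counted. The value is `⊤` if the loop never stops. -/
def numPoints (g : ℝ → ℝ) (K L x : ℝ) (u : Draw → ℝ) : ℕ∞ :=
  ⨅ k ∈ {k : ℕ | u .proposal < (loopState g K L x u k).E1 ∨ (loopState g K L x u (k + 1)).W},
    ((k + 1 : ℕ) : ℕ∞)

end

section Draws

/-! Rejection can only end the iteration earlier, so the number of points is at most one plus the
number of points up to `T` of a Poisson process of rate `K` (`numPoints_le`). As `T` is independent
of the gaps, the mean of this count is controlled by `K 𝔼[T]` (`tsum_measure_partialSum_le`): by the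
renewal equation, each new gap lowers `K 𝔼[R⁺]`, with `R` the residual time, by exactly the
probability that the next point is still at most `T`, and these losses telescope.

Finally `𝔼[T] = m` (`lintegral_id_invGaussianMeasure`): the substitution `t ↦ m² / t` turns the
density `p(t)` into `t p(t) / m`, so the total mass is the mean divided by `m`. The bound follows
from `K ≤ κ`. The drift, the bridge and the uniform variables matter only for measurability. -/

lemma Draw.countable : Countable Draw := by
  let f : Draw → Option (ℕ ⊕ ℕ ⊕ ℕ × Fin 3) := fun d => match d with
    | .proposal => none
    | .gap n => some (.inl n)
    | .unif n => some (.inr (.inl n))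
    | .gauss n j => some (.inr (.inr (n, j)))
  refine Function.Injective.countable (f := f) ?_
  rintro (_ | n | n | ⟨n, j⟩) (_ | m | m | ⟨m, i⟩) h <;> simp_all [f]

end Draws

/-! ### Mean of the inverse Gaussian law. -/

section InverseGaussian

/-- The density of the inverse Gaussian law on `]0, ∞[`. -/
noncomputable def invGaussianDensity (m l t : ℝ) : ℝ :=
  Real.sqrt (l / (2 * Real.pi * t ^ 3)) * Real.exp (-(l * (t - m) ^ 2) / (2 * m ^ 2 * t))

lemma measurable_invGaussianDensity (m l : ℝ) : Measurable (invGaussianDensity m l) := by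
  unfold invGaussianDensity
  fun_prop

lemma invGaussianDensity_nonneg (m l t : ℝ) : 0 ≤ invGaussianDensity m l t := by
  unfold invGaussianDensity
  positivity

lemma lintegral_invGaussianMeasure (m l : ℝ) {f : ℝ → ℝ≥0∞} (hf : Measurable f) :
    ∫⁻ t, f t ∂invGaussianMeasure m l =
      ∫⁻ t in Set.Ioi 0, ENNReal.ofReal (invGaussianDensity m l t) * f t := by
  have h := (measurable_invGaussianDensity m l).ennreal_ofReal
  exact lintegral_withDensity_eq_lintegral_mul _ h hf

/-- The inverse Gaussian density under the substitution `t ↦ m² / t`. -/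
lemma invGaussianDensity_inversion {m l t : ℝ} (hm : 0 < m) (ht : 0 < t) :
    m ^ 2 / t ^ 2 * invGaussianDensity m l (m ^ 2 / t) =
      m⁻¹ * (invGaussianDensity m l t * t) := by
  have hexp : -(l * (m ^ 2 / t - m) ^ 2) / (2 * m ^ 2 * (m ^ 2 / t)) =
      -(l * (t - m) ^ 2) / (2 * m ^ 2 * t) := by
    field_simp
    ring
  have hsqrt : Real.sqrt (l / (2 * Real.pi * (m ^ 2 / t) ^ 3)) =
      (t / m) ^ 3 * Real.sqrt (l / (2 * Real.pi * t ^ 3)) := by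
    have : l / (2 * Real.pi * (m ^ 2 / t) ^ 3) =
        ((t / m) ^ 3) ^ 2 * (l / (2 * Real.pi * t ^ 3)) := by
      have := Real.pi_pos
      field_simp
    rw [this, Real.sqrt_mul (by positivity), Real.sqrt_sq (by positivity)]
  unfold invGaussianDensity
  rw [hexp, hsqrt]
  field_simp

/-- The mean of an inverse Gaussian law is its first parameter, relative to the total mass. -/
lemma lintegral_id_invGaussianMeasure {m l : ℝ} (hm : 0 < m) :
    ∫⁻ t, ENNReal.ofReal t ∂invGaussianMeasure m l =
      ENNReal.ofReal m * invGaussianMeasure m l Set.univ := by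
  have himage : (fun t : ℝ => m ^ 2 / t) '' Set.Ioi 0 = Set.Ioi 0 := by
    ext t
    constructor
    · rintro ⟨s, hs, rfl⟩
      have : 0 < s := hs
      exact Set.mem_Ioi.2 (by positivity)
    · intro ht
      have : 0 < t := ht
      refine ⟨m ^ 2 / t, Set.mem_Ioi.2 (by positivity), ?_⟩
      simp only
      field_simp
  have hderiv : ∀ t ∈ Set.Ioi (0 : ℝ),
      HasDerivWithinAt (fun t : ℝ => m ^ 2 / t) (-(m ^ 2 / t ^ 2)) (Set.Ioi 0) t := by
    intro t ht
    have h := ((hasDerivAt_inv (ne_of_gt ht)).const_mul (m ^ 2)).hasDerivWithinAt (s := Set.Ioi 0)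
    simpa [div_eq_mul_inv] using h
  have hinj : Set.InjOn (fun t : ℝ => m ^ 2 / t) (Set.Ioi 0) := by
    intro s hs t ht h
    have hs' : 0 < s := hs
    have ht' : 0 < t := ht
    simp only at h
    field_simp at h
    exact h.symm
  have hmass : invGaussianMeasure m l Set.univ =
      ENNReal.ofReal m⁻¹ * ∫⁻ t, ENNReal.ofReal t ∂invGaussianMeasure m l := by
    rw [← lintegral_one, lintegral_invGaussianMeasure m l measurable_const,
      lintegral_invGaussianMeasure m l ENNReal.measurable_ofReal]
    -- Only the integral for the mass is transformed: `t ↦ m² / t` maps `]0, ∞[` bijectively onto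
    -- itself.
    conv_lhs => rw [← himage]
    rw [lintegral_image_eq_lintegral_abs_deriv_mul measurableSet_Ioi hderiv hinj,
      ← lintegral_const_mul' _ _ ENNReal.ofReal_ne_top]
    refine setLIntegral_congr_fun measurableSet_Ioi fun t ht => ?_
    have ht' : 0 < t := ht
    simp only [mul_one, abs_neg]
    rw [abs_of_nonneg (by positivity), ← ENNReal.ofReal_mul (by positivity),
      invGaussianDensity_inversion hm ht', ENNReal.ofReal_mul (by positivity),
      ENNReal.ofReal_mul (invGaussianDensity_nonneg m l t)]
  rw [hmass, ← mul_assoc, ← ENNReal.ofReal_mul hm.le, mul_inv_cancel₀ hm.ne']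
  simp

end InverseGaussian

/-! ### Expected number of Poisson points before an independent time. -/

section ExponentialRenewal

/-- The function `r ↦ K r⁺` solves the renewal equation of a Poisson process of rate `K`. -/
lemma lintegral_expMeasure_renewal {K : ℝ} (hK : 0 < K) (r : ℝ) :
    ∫⁻ s, ((if 0 ≤ r - s then 1 else 0) + ENNReal.ofReal (K * (r - s))) ∂expMeasure K =
      ENNReal.ofReal (K * r) := by
  have hmeas : Measurable fun s : ℝ =>
      ((if 0 ≤ r - s then 1 else 0) + ENNReal.ofReal (K * (r - s)) : ℝ≥0∞) := by
    refine (Measurable.ite ?_ measurable_const measurable_const).add (by fun_prop)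
    exact measurableSet_le measurable_const (by fun_prop)
  have hpdf : Measurable (exponentialPDF K) :=
    (measurable_exponentialPDFReal K).ennreal_ofReal
  have hdens : ∫⁻ s, ((if 0 ≤ r - s then 1 else 0) + ENNReal.ofReal (K * (r - s))) ∂expMeasure K =
      ∫⁻ s, exponentialPDF K s *
        ((if 0 ≤ r - s then 1 else 0) + ENNReal.ofReal (K * (r - s))) :=
    lintegral_withDensity_eq_lintegral_mul _ hpdf hmeas
  -- The density vanishes for `s < 0`, and both terms of the other factor vanish for `s > r`.
  have hint : ∀ s, exponentialPDF K s *
      ((if 0 ≤ r - s then 1 else 0) + ENNReal.ofReal (K * (r - s))) =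
      (Set.Icc 0 r).indicator
        (fun s => ENNReal.ofReal (K * Real.exp (-(K * s)) * (1 + K * (r - s)))) s := by
    intro s
    rcases lt_or_ge s 0 with hs | hs
    · rw [exponentialPDF_of_neg hs, zero_mul, Set.indicator_of_notMem]
      exact fun h => absurd h.1 (not_le.2 hs)
    rcases lt_or_ge r s with hr | hr
    · rw [Set.indicator_of_notMem fun h => absurd h.2 (not_le.2 hr), if_neg (by linarith),
        ENNReal.ofReal_of_nonpos (mul_nonpos_of_nonneg_of_nonpos hK.le (by linarith))]
      simp
    · have h : 0 ≤ K * (r - s) := mul_nonneg hK.le (by linarith)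
      rw [Set.indicator_of_mem (Set.mem_Icc.2 ⟨hs, hr⟩), if_pos (by linarith),
        exponentialPDF_of_nonneg hs, ← ENNReal.ofReal_one, ← ENNReal.ofReal_add zero_le_one h,
        ← ENNReal.ofReal_mul (by positivity)]
  rw [hdens, lintegral_congr hint, lintegral_indicator measurableSet_Icc]
  rcases lt_or_ge r 0 with hr | hr
  · rw [Set.Icc_eq_empty (not_le.2 hr),
      ENNReal.ofReal_of_nonpos (mul_nonpos_of_nonneg_of_nonpos hK.le hr.le)]
    simp
  have hcont : Continuous fun s : ℝ => K * Real.exp (-(K * s)) * (1 + K * (r - s)) := by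
    fun_prop
  rw [← ofReal_integral_eq_lintegral_ofReal (hcont.integrableOn_Icc), integral_Icc_eq_integral_Ioc,
    ← intervalIntegral.integral_of_le hr,
    -- This primitive is `0` at `s = r` and `-K r` at `s = 0`.
    intervalIntegral.integral_eq_sub_of_hasDerivAt
      (f := fun s => -(K * (r - s) * Real.exp (-(K * s))))]
  · simp
  · intro s _
    have h₁ : HasDerivAt (fun s => Real.exp (-(K * s))) (Real.exp (-(K * s)) * -(K * 1)) s :=
      (((hasDerivAt_id s).const_mul K).neg).exp
    have h₂ : HasDerivAt (fun s => K * (r - s)) (K * -1) s :=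
      ((hasDerivAt_id s).const_sub r).const_mul K
    exact (h₂.mul h₁).neg.congr_deriv (by ring)
  · exact hcont.intervalIntegrable _ _
  · refine (ae_restrict_iff' measurableSet_Icc).2 (ae_of_all _ fun s hs => ?_)
    have : 0 ≤ K * (r - s) := mul_nonneg hK.le (by linarith [hs.2])
    positivity

/-- One step of the renewal equation for a residual time `R` and an independent exponential
variable `e`. -/
lemma measure_add_lintegral_residual {Ω : Type*} [MeasurableSpace Ω] {P : Measure Ω}
    [IsProbabilityMeasure P] {K : ℝ} (hK : 0 < K) {R e : Ω → ℝ} (hR : AEMeasurable R P)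
    (he : HasLaw e (expMeasure K) P) (hind : IndepFun R e P) :
    (∫⁻ ω, (if 0 ≤ R ω - e ω then 1 else 0) ∂P) + ∫⁻ ω, ENNReal.ofReal (K * (R ω - e ω)) ∂P =
      ∫⁻ ω, ENNReal.ofReal (K * R ω) ∂P := by
  have : IsProbabilityMeasure (expMeasure K) := isProbabilityMeasure_expMeasure hK
  have hmeas : Measurable fun p : ℝ × ℝ =>
      ((if 0 ≤ p.1 - p.2 then 1 else 0) + ENNReal.ofReal (K * (p.1 - p.2)) : ℝ≥0∞) := by
    refine (Measurable.ite ?_ measurable_const measurable_const).add (by fun_prop)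
    exact measurableSet_le measurable_const (by fun_prop)
  have hem := he.aemeasurable
  rw [← lintegral_add_right' _ (by fun_prop)]
  have hmap := lintegral_map' (μ := P) (g := fun ω => (R ω, e ω)) hmeas.aemeasurable
    (hR.prodMk hem)
  simp only at hmap
  rw [← hmap, hind.map_prod_eq_prod_map_map hR hem, he.map_eq,
    lintegral_prod _ hmeas.aemeasurable]
  simp only [lintegral_expMeasure_renewal hK]
  exact lintegral_map' (by fun_prop) hR

/-- The expected number of points up to an independent random time `Y none` of a Poisson process
of rate `K` with gaps `Y (some i)` is at most `K` times the mean of the random time. -/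
lemma tsum_measure_partialSum_le {Ω : Type*} [MeasurableSpace Ω] {P : Measure Ω}
    [IsProbabilityMeasure P] {K : ℝ} (hK : 0 < K) {Y : Option ℕ → Ω → ℝ}
    (hT : AEMeasurable (Y none) P) (he : ∀ i, HasLaw (Y (some i)) (expMeasure K) P)
    (hind : iIndepFun Y P) :
    ∑' n, ∫⁻ ω, (if ∑ i ∈ Finset.range (n + 1), Y (some i) ω ≤ Y none ω then 1 else 0) ∂P ≤
      ∫⁻ ω, ENNReal.ofReal (K * Y none ω) ∂P := by
  set R : ℕ → Ω → ℝ := fun n ω => Y none ω - ∑ i ∈ Finset.range n, Y (some i) ω with hRdef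
  have hRm : ∀ n, AEMeasurable (R n) P := fun n =>
    hT.sub (Finset.aemeasurable_fun_sum _ fun i _ => (he i).aemeasurable)
  have hRsucc : ∀ n ω, R (n + 1) ω = R n ω - Y (some n) ω := by
    intro n ω
    simp only [hRdef, Finset.sum_range_succ]
    ring
  have hRind : ∀ n, IndepFun (R n) (Y (some n)) P := by
    intro n
    -- With the gaps negated, the residual time is a plain finite sum of independent variables, none
    -- of them the `n`-th gap; the sign of that gap is restored afterwards.
    let σ : Option ℕ → ℝ → ℝ := fun o => match o with
      | none => id
      | some _ => Neg.neg
    have hσ : ∀ o, Measurable (σ o) := by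
      rintro (_ | i)
      exacts [measurable_id, measurable_neg]
    have hYm : ∀ o, AEMeasurable (Y o) P := by
      rintro (_ | i)
      exacts [hT, (he i).aemeasurable]
    have h := (hind.comp σ hσ).indepFun_finsetSum_of_notMem₀
      (fun o => (hσ o).comp_aemeasurable (hYm o))
      (s := Finset.insertNone (Finset.range n)) (i := some n) (by simp)
    have h' := h.comp measurable_id measurable_neg
    convert h' using 1
    · ext ω
      simp [hRdef, σ, Finset.sum_insertNone, Finset.sum_apply, sub_eq_add_neg]
    · ext ω
      simp [σ]
  have hstep : ∀ n, (∫⁻ ω, (if 0 ≤ R (n + 1) ω then 1 else 0) ∂P) +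
      ∫⁻ ω, ENNReal.ofReal (K * R (n + 1) ω) ∂P = ∫⁻ ω, ENNReal.ofReal (K * R n ω) ∂P := by
    intro n
    simp only [hRsucc]
    exact measure_add_lintegral_residual hK (hRm n) (he n) (hRind n)
  -- Conserved quantity: the expected count so far plus `K` times the mean positive residual.
  -- Dropping the residual bounds every partial sum.
  have hsum : ∀ n, (∑ k ∈ Finset.range n, ∫⁻ ω, (if 0 ≤ R (k + 1) ω then 1 else 0) ∂P) +
      ∫⁻ ω, ENNReal.ofReal (K * R n ω) ∂P = ∫⁻ ω, ENNReal.ofReal (K * Y none ω) ∂P := by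
    intro n
    induction n with
    | zero => simp [hRdef]
    | succ n ih => rw [Finset.sum_range_succ, add_assoc, hstep, ih]
  have hiff : ∀ n ω, ∑ i ∈ Finset.range n, Y (some i) ω ≤ Y none ω ↔ 0 ≤ R n ω :=
    fun n ω => sub_nonneg.symm
  simp only [hiff]
  refine ENNReal.tsum_le_of_sum_range_le fun n => ?_
  rw [← hsum n]
  exact le_self_add

end ExponentialRenewal

/-! ### Measurability of the loop and comparison with the Poisson count. -/

section Loop

/-- `E1` holds the first gap before any execution of the loop body, hence the shift by one. -/
lemma loopState_E1 (g : ℝ → ℝ) (K L x : ℝ) (u : Draw → ℝ) (n : ℕ) :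
    (loopState g K L x u n).E1 = ∑ i ∈ Finset.range (n + 1), u (.gap i) := by
  induction n with
  | zero => simp [loopState]
  | succ n ih => rw [Finset.sum_range_succ, ← ih]; rfl

lemma measurable_loopState (g : ℝ → ℝ) (K L x : ℝ) (n : ℕ) :
    Measurable (fun u => (loopState g K L x u n).β) ∧
    Measurable (fun u => (loopState g K L x u n).E0) ∧
    Measurable (fun u => (loopState g K L x u n).E1) := by
  induction n with
  | zero => exact ⟨measurable_const, measurable_const, measurable_pi_apply _⟩
  | succ n ih =>
    obtain ⟨hβ, hE0, hE1⟩ := ih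
    refine ⟨?_, hE1, hE1.add (measurable_pi_apply _)⟩
    have hG : Measurable fun u : Draw → ℝ =>
        (WithLp.toLp 2 fun j => u (.gauss n j) : EuclideanSpace ℝ (Fin 3)) :=
      (WithLp.measurable_toLp 2 (Fin 3 → ℝ)).comp
        (measurable_pi_lambda _ fun j => measurable_pi_apply _)
    have hT : Measurable fun u : Draw → ℝ => u .proposal := measurable_pi_apply _
    exact (((hT.sub hE1).div (hT.sub hE0)).smul hβ).add
      (((((hT.sub hE1).mul (hE1.sub hE0)).div (hT.sub hE0)).sqrt).smul hG)

lemma measurableSet_loopState_W {g : ℝ → ℝ} {L : ℝ}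
    (hg : Measurable fun z : EuclideanSpace ℝ (Fin 3) => g (L - ‖z‖)) (K x : ℝ) (n : ℕ) :
    MeasurableSet {u | (loopState g K L x u n).W} := by
  cases n with
  | zero => exact MeasurableSet.const False
  | succ n =>
    have hβ := (measurable_loopState g K L x (n + 1)).1
    have hE1 := (measurable_loopState g K L x n).2.2
    have hT : Measurable fun u : Draw → ℝ => u .proposal := measurable_pi_apply _
    have hz : Measurable fun u => ((loopState g K L x u n).E1 * (L - x) / u .proposal) •
        EuclideanSpace.single (0 : Fin 3) (1 : ℝ) + (loopState g K L x u (n + 1)).β :=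
      (((hE1.mul_const _).div hT).smul_const _).add hβ
    have hV : Measurable fun u : Draw → ℝ => K * u (.unif n) := by fun_prop
    exact measurableSet_le hV (hg.comp hz)

lemma measurable_numPoints {g : ℝ → ℝ} {L : ℝ}
    (hg : Measurable fun z : EuclideanSpace ℝ (Fin 3) => g (L - ‖z‖)) (K x : ℝ) :
    Measurable fun u => (numPoints g K L x u : ℝ≥0∞) := by
  classical
  have h : ∀ u, (numPoints g K L x u : ℝ≥0∞) =
      ⨅ k : ℕ, if u .proposal < (loopState g K L x u k).E1 ∨ (loopState g K L x u (k + 1)).W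
        then ((k + 1 : ℕ) : ℝ≥0∞) else ⊤ := by
    intro u
    simp only [numPoints, ENat.toENNReal_iInf, ENat.toENNReal_coe]
    refine iInf_congr fun k => ?_
    rw [iInf_eq_if]
    rfl
  simp only [h]
  refine Measurable.iInf fun k => Measurable.ite ?_ measurable_const measurable_const
  exact (measurableSet_lt (measurable_pi_apply _) (measurable_loopState g K L x k).2.2).union
    (measurableSet_loopState_W hg K x (k + 1))

/-- The number of points used is at most one plus the number of points up to the proposal. -/
lemma numPoints_le (g : ℝ → ℝ) (K L x : ℝ) (u : Draw → ℝ) :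
    (numPoints g K L x u : ℝ≥0∞) ≤
      1 + ∑' n, if ∑ i ∈ Finset.range (n + 1), u (.gap i) ≤ u .proposal then 1 else 0 := by
  classical
  simp only [← loopState_E1 g K L x u]
  by_cases hex : ∃ k, u .proposal < (loopState g K L x u k).E1
  -- By minimality of `k`, each of the `k` earlier points is at most `T`, so the series is at least
  -- `k`.
  · set k := Nat.find hex
    have hk : u .proposal < (loopState g K L x u k).E1 := Nat.find_spec hex
    have hle : numPoints g K L x u ≤ ((k + 1 : ℕ) : ℕ∞) := iInf₂_le k (Or.inl hk)
    calc (numPoints g K L x u : ℝ≥0∞) ≤ (((k + 1 : ℕ) : ℕ∞) : ℝ≥0∞) := ENat.toENNReal_le.2 hle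
      _ = 1 + ∑ n ∈ Finset.range k,
          (if (loopState g K L x u n).E1 ≤ u .proposal then 1 else 0 : ℝ≥0∞) := by
        rw [Finset.sum_congr rfl fun n hn => if_pos
          (not_lt.1 (Nat.find_min hex (Finset.mem_range.1 hn)))]
        simp only [Finset.sum_const, Finset.card_range, ENat.toENNReal_coe, nsmul_one, add_comm]
        push_cast
        rfl
      _ ≤ _ := by gcongr; exact ENNReal.sum_le_tsum _
  -- If no point exceeds `T`, every term of the series is `1` and the right-hand side is infinite.
  · push Not at hex
    simp [hex]

end Loop

lemma continuousOn_driftGamma {b : ℝ → ℝ} {L : ℝ} (hb : ContDiffOn ℝ 1 b (Set.Iic L)) :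
    ContinuousOn (driftGamma b L) (Set.Iic L) :=
  ((hb.continuousOn.pow 2).add
    (hb.continuousOn_derivWithin (uniqueDiffOn_Iic L) le_rfl)).div_const 2

/-- Since `L - ‖z‖ ≤ L`, only values on `]-∞, L]` enter, where `driftGamma` is continuous; its
behaviour beyond `L` is irrelevant. -/
lemma measurable_driftGamma_comp_norm {E : Type*} [NormedAddCommGroup E] [MeasurableSpace E]
    [BorelSpace E] {b : ℝ → ℝ} {L : ℝ} (hb : ContDiffOn ℝ 1 b (Set.Iic L)) (c : ℝ) :
    Measurable fun z : E => driftGamma b L (L - ‖z‖) - c := by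
  have h : Continuous fun z : E => driftGamma b L (L - ‖z‖) :=
    (continuousOn_driftGamma hb).comp_continuous (by fun_prop)
      fun z => sub_le_self L (norm_nonneg z)
  exact (h.sub continuous_const).measurable

theorem mainTheorem10
    (b : ℝ → ℝ) (x L κ γ₀ K : ℝ) (hxL : x < L)
    (hb : ContDiffOn ℝ 1 b (Set.Iic L))
    (hγ₀ : 0 < γ₀) (hκ : γ₀ < κ)
    (hγ : ∀ y ∈ Set.Iic L, γ₀ ≤ driftGamma b L y ∧ driftGamma b L y ≤ κ)
    -- the dominating constant of the shifted algorithm: `κ`, or its shifted value `κ - γ₀`,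
    -- or anything between the two
    (hK : κ - γ₀ ≤ K) (hK' : K ≤ κ)
    {Ω : Type*} [MeasurableSpace Ω] (P : Measure Ω) [IsProbabilityMeasure P]
    (X : Draw → Ω → ℝ)
    (hlaw : ∀ d, HasLaw (X d)
      (drawLaw (invGaussianMeasure ((L - x) / Real.sqrt (2 * γ₀)) ((L - x) ^ 2)) K d) P)
    (hindep : iIndepFun X P) :
    AEMeasurable
      (fun ω => (numPoints (fun y => driftGamma b L y - γ₀) K L x (fun d => X d ω) : ℝ≥0∞)) P ∧
    ∫⁻ ω, (numPoints (fun y => driftGamma b L y - γ₀) K L x (fun d => X d ω) : ℝ≥0∞) ∂P ≤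
      ENNReal.ofReal (1 + κ * ((L - x) / Real.sqrt (2 * γ₀))) := by
  -- Countability makes the joint family of draws almost everywhere measurable.
  have := Draw.countable
  set m := (L - x) / Real.sqrt (2 * γ₀) with hm
  have hmpos : 0 < m := div_pos (sub_pos.2 hxL) (Real.sqrt_pos.2 (by linarith))
  have hKpos : 0 < K := by linarith
  have hXm : ∀ d, AEMeasurable (X d) P := fun d => (hlaw d).aemeasurable
  have hT : HasLaw (X .proposal) (invGaussianMeasure m ((L - x) ^ 2)) P := hlaw .proposal
  have hNm := (measurable_numPoints (g := fun y => driftGamma b L y - γ₀) (L := L)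
    (measurable_driftGamma_comp_norm hb γ₀) K x).comp_aemeasurable (aemeasurable_pi_lambda _ hXm)
  refine ⟨hNm, ?_⟩
  -- The mass is `1` because the measure is the law of `T` under a probability; no integral is
  -- computed.
  have hmass : invGaussianMeasure m ((L - x) ^ 2) Set.univ = 1 := by
    rw [← hT.map_eq, Measure.map_apply_of_aemeasurable hT.aemeasurable MeasurableSet.univ]
    simp
  have hmean : ∫⁻ ω, ENNReal.ofReal (X .proposal ω) ∂P = ENNReal.ofReal m := by
    have h := lintegral_map' (μ := P) ENNReal.measurable_ofReal.aemeasurable hT.aemeasurable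
    rw [← h, hT.map_eq, lintegral_id_invGaussianMeasure hmpos, hmass, mul_one]
  -- The Poisson count involves only the proposal and the gaps.
  let ι : Option ℕ → Draw := fun o => o.elim .proposal .gap
  have hι : Function.Injective ι := by
    rintro (_ | i) (_ | j) h <;> simp_all [ι]
  have hcount := tsum_measure_partialSum_le (Y := fun o => X (ι o)) hKpos (hXm _)
    (fun i => hlaw (.gap i)) (hindep.precomp hι)
  have hind : ∀ n, AEMeasurable (fun ω => (if ∑ i ∈ Finset.range (n + 1), X (.gap i) ω ≤
      X .proposal ω then 1 else 0 : ℝ≥0∞)) P := by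
    intro n
    have h : Measurable fun u : Draw → ℝ => (if ∑ i ∈ Finset.range (n + 1), u (.gap i) ≤
        u .proposal then 1 else 0 : ℝ≥0∞) :=
      Measurable.ite (measurableSet_le (by fun_prop) (by fun_prop)) measurable_const
        measurable_const
    exact h.comp_aemeasurable (aemeasurable_pi_lambda _ hXm)
  calc _ ≤ ∫⁻ ω, (1 + ∑' n, if ∑ i ∈ Finset.range (n + 1), X (.gap i) ω ≤ X .proposal ω
          then 1 else 0) ∂P := lintegral_mono fun ω => numPoints_le _ K L x fun d => X d ω
    _ = 1 + ∑' n, ∫⁻ ω, (if ∑ i ∈ Finset.range (n + 1), X (.gap i) ω ≤ X .proposal ω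
          then 1 else 0) ∂P := by
      rw [lintegral_add_left measurable_const, lintegral_tsum hind]
      simp
    _ ≤ 1 + ∫⁻ ω, ENNReal.ofReal (K * X .proposal ω) ∂P := by gcongr; exact hcount
    _ = ENNReal.ofReal (1 + K * m) := by
      simp only [ENNReal.ofReal_mul hKpos.le]
      rw [lintegral_const_mul' _ _ ENNReal.ofReal_ne_top, hmean,
        ENNReal.ofReal_add zero_le_one (by positivity), ENNReal.ofReal_mul hKpos.le,
        ENNReal.ofReal_one]
    _ ≤ ENNReal.ofReal (1 + κ * m) := by gcongr
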